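/- Consider the adversarial bandit game with $K\ge 1$ arms and $T\ge 1$ rounds. An oblivious adversary fixes, possibly at random, gains $g_{i,t}\in[0,1]$ for all arms $i$ and rounds $t$ before the game. The algorithm DP-EXP3-Lap with privacy parameter $\varepsilon>0$ uses $$b=\frac{\ln T}{\varepsilon},\qquad \gamma=\min\Big\{1,\sqrt{\tfrac{K\ln K}{(e-1)T}}\Big\},$$ and estimates $\tilde G_1=\dots=\tilde G_K=0$ at the start. In round $t$ it draws an arm $I_t$ from the distribution $$p_{i,t}=(1-\gamma)\frac{\exp(\frac{\gamma}{K}\tilde G_i)}{\sum_{j=1}^K\exp(\frac{\gamma}{K}\tilde G_j)}+\frac{\gamma}{K},$$ forms the noisy gain $g'_t=g_{I_t,t}+\mathcal N_t$, where $\mathcal N_t$ is fresh independent Laplace noise of scale $1/\varepsilon$, and, if $g'_t\in[-b,b+1]$, adds $\frac{1}{p_{I_t,t}}\cdot\frac{g'_t+b}{2b+1}$ to $\tilde G_{I_t}$; otherwise the round is ignored. (This is EXP3 run as the base algorithm on the accepted, rescaled noisy gains.) Let $$\mathcal R=\max_{1\le i\le K}\sum_{t=1}^T g_{i,t}-\sum_{t=1}^T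 g_{I_t,t}.$$ Then $\mathcal R$ is integrable (the expectation being over the adversary, the noise and the arms), and: 1. for every $\varepsilon>0$, $$\mathbb E\,\mathcal R\le\Big(\frac{4\ln T}{\varepsilon}+2\Big)\sqrt{(e-1)TK\ln K}+2K+\frac{\sqrt{32T}}{\varepsilon};$$ 2. if $\varepsilon\le 1$ or $\ln T\ge 2\varepsilon$ (so, for any fixed $\varepsilon$, for all large $T$), then $$\mathbb E\,\mathcal R\le\frac{4\ln T}{\varepsilon}\sqrt{(e-1)TK\ln K}+2K+\frac{\sqrt{32T}}{\varepsilon};$$ 3. consequently $\mathbb E\,\mathcal R=O(\sqrt T\,\ln T/\varepsilon)$: there is a constant $C$ depending only on $K$ such that $\mathbb E\,\mathcal R\le C\sqrt T\,\ln T/\varepsilon$ for all $T\ge 2$, all $\varepsilon>0$ with $\varepsilon\le 1$ or $\ln T\ge 2\varepsilon$, and all oblivious adversaries. -/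

import Mathlib

open MeasureTheory
open scoped ENNReal unitInterval

namespace DPBandit

/-- A randomized bandit algorithm: it maps each finite chronological history of pairs
(arm played, gain observed) to a distribution over the next arm. -/
abbrev BanditAlgorithm (K : ℕ) : Type := List (Fin K × ℝ) → PMF (Fin K)

/-- The arm probabilities of EXP3 with exploration rate `γ`, when the estimated cumulative
gains of the arms are `G`. -/
noncomputable def exp3Prob {K : ℕ} (γ : ℝ) (G : Fin K → ℝ) (i : Fin K) : ℝ :=
  (1 - γ) * (Real.exp (γ / K * G i) / ∑ j, Real.exp (γ / K * G j)) + γ / K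

theorem exp3Prob_nonneg {K : ℕ} (γ : I) (G : Fin K → ℝ) (i : Fin K) :
    0 ≤ exp3Prob (γ : ℝ) G i := by
  have h0 : (0 : ℝ) ≤ γ := γ.2.1
  have h1 : (0 : ℝ) ≤ 1 - γ := sub_nonneg.2 γ.2.2
  unfold exp3Prob
  positivity

theorem exp3Prob_sum {K : ℕ} [NeZero K] (γ : ℝ) (G : Fin K → ℝ) :
    ∑ i, exp3Prob γ G i = 1 := by
  have hS : 0 < ∑ j : Fin K, Real.exp (γ / K * G j) :=
    Finset.sum_pos (fun j _ => Real.exp_pos _) Finset.univ_nonempty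
  have hK : (K : ℝ) ≠ 0 := Nat.cast_ne_zero.2 (NeZero.ne K)
  simp only [exp3Prob, Finset.sum_add_distrib, ← Finset.mul_sum, ← Finset.sum_div,
    Finset.sum_const, Finset.card_univ, Fintype.card_fin, nsmul_eq_mul]
  field_simp
  ring

/-- One EXP3 update of the estimated cumulative gains: after arm `r.1` is played and gain `r.2`
is observed, `r.2 / p` is added to the estimate of that arm, with `p` the probability with which
it was played. -/
noncomputable def exp3Update {K : ℕ} (γ : ℝ) (G : Fin K → ℝ) (r : Fin K × ℝ) : Fin K → ℝ :=
  G + Pi.single r.1 (r.2 / exp3Prob γ G r.1)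

/-- The estimated cumulative gains after a history, starting from zero. -/
noncomputable def exp3Estimate {K : ℕ} (γ : ℝ) (h : List (Fin K × ℝ)) : Fin K → ℝ :=
  h.foldl (exp3Update γ) 0

/-- The algorithm EXP3 with exploration rate `γ ∈ [0, 1]`. -/
noncomputable def exp3 {K : ℕ} [NeZero K] (γ : I) : BanditAlgorithm K := fun h =>
  PMF.ofFintype (fun i => ENNReal.ofReal (exp3Prob (γ : ℝ) (exp3Estimate (γ : ℝ) h) i)) (by
    rw [← ENNReal.ofReal_sum_of_nonneg fun i _ => exp3Prob_nonneg γ _ i, exp3Prob_sum,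
      ENNReal.ofReal_one])

open Classical in
/-- Keep a round when its noisy gain lies in `[-b, b + 1]`, with that gain rescaled to `[0, 1]`;
drop it otherwise. -/
noncomputable def rescale {K : ℕ} (b : ℝ) (r : Fin K × ℝ) : Option (Fin K × ℝ) :=
  if r.2 ∈ Set.Icc (-b) (b + 1) then some (r.1, (r.2 + b) / (2 * b + 1)) else none

/-- The wrapper with threshold `b`: the base algorithm sees only the accepted rounds of the noisy
history, with rescaled gains. -/
noncomputable def dpLap {K : ℕ} (base : BanditAlgorithm K) (b : ℝ) : BanditAlgorithm K :=
  fun h => base (h.filterMap (rescale b))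

/-- The Laplace distribution on `ℝ`, centred at `0`, of scale `s > 0`. -/
noncomputable def laplace (s : ℝ) : Measure ℝ :=
  volume.withDensity fun x => ENNReal.ofReal (1 / (2 * s) * Real.exp (-|x| / s))

/-- All that happens in a game of `T` rounds: the gains `g t i` of all arms, the noise of each
round, and the arms played. -/
abbrev Game (K T : ℕ) : Type := (Fin T → Fin K → ℝ) × (Fin T → ℝ) × (Fin T → Fin K)

/-- The noisy history (arm, gain of that arm plus noise) strictly before round `t`. -/
noncomputable def noisyHistory {K T : ℕ} (ω : Game K T) (t : Fin T) : List (Fin K × ℝ) :=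
  (List.ofFn fun s : Fin T => (ω.2.2 s, ω.1 s (ω.2.2 s) + ω.2.1 s)).take t

/-- The joint law of gains, noise and arms when an oblivious adversary draws the gains of all
rounds from `μ`, the noise of every round is drawn independently from `ν`, and in each round
`alg` picks the arm from the noisy history of the earlier rounds: relative to
`μ ⊗ ν^T ⊗ counting`, the density is the product of the conditional probabilities of the arms. -/
noncomputable def gameLaw {K T : ℕ} (alg : BanditAlgorithm K) (ν : Measure ℝ)
    (μ : Measure (Fin T → Fin K → ℝ)) : Measure (Game K T) :=
  (μ.prod ((Measure.pi fun _ : Fin T => ν).prod Measure.count)).withDensity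
    fun ω => ∏ t, alg (noisyHistory ω t) (ω.2.2 t)

/-- Regret against the best fixed arm in hindsight, in terms of the true gains. -/
noncomputable def regret {K T : ℕ} (ω : Game K T) : ℝ :=
  (⨆ i, ∑ t, ω.1 t i) - ∑ t, ω.1 t (ω.2.2 t)

/-- The EXP3 exploration rate `min {1, √(K ln K / ((e - 1) T))}`. -/
noncomputable def exp3Rate (K T : ℕ) : I :=
  ⟨min 1 √(K * Real.log K / ((Real.exp 1 - 1) * T)),
    le_min zero_le_one (Real.sqrt_nonneg _), min_le_left _ _⟩

/-- The law of a run of DP-EXP3-Lap over `T` rounds with privacy parameter `ε`, i.e. the wrapper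
with base EXP3, threshold `b = ln T / ε` and Laplace noise of scale `1 / ε`. -/
noncomputable def dpExp3LapLaw {K T : ℕ} [NeZero K] (ε : ℝ)
    (μ : Measure (Fin T → Fin K → ℝ)) : Measure (Game K T) :=
  gameLaw (dpLap (exp3 (exp3Rate K T)) (Real.log T / ε)) (laplace (1 / ε)) μ

/-- An oblivious adversary: a distribution over the gains of all arms in all rounds, with gains in
`[0, 1]`. -/
structure IsAdversary {K T : ℕ} (μ : Measure (Fin T → Fin K → ℝ)) : Prop where
  prob : IsProbabilityMeasure μ
  mem_Icc : ∀ᵐ g ∂μ, ∀ t i, g t i ∈ Set.Icc (0 : ℝ) 1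

end DPBandit

namespace DPBandit

/-! A rejected round leaves the EXP3 estimates unchanged, exactly as a round with gain `0` would.
Hence the algorithm is plain EXP3 run on the truncated gains `truncatedGain b (g + n)`, which lie in
`[0, 1]`, are fresh in every round, and have mean `meanGain ε b g`.

Up to the factor `2b + 1`, this mean is `b + g` plus a tail correction of order `exp (-εb)`. So a
difference of true gains is at most `2b + 1` times the difference of means, plus `exp (-εb) (b +
3/2)` (`sub_le_meanGain_sub`). For `b = ln T / ε` the exponential is `1 / T`, and the total bias
over `T` rounds is only `b + 3/2`.

For the means, the potential argument of EXP3 (`exp3Potential_add_le_sum`, iterated in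
`exp3Potential_add_le_integral_armsMean`) bounds the regret by `(e - 1) γ T m + (K / γ) ln K`, where
`m` bounds every mean. Since `m = (b + 1) / (2b + 1)` is admissible (`meanGain_le`), scaling back by
`2b + 1` turns the first factor into `b + 1` instead of `2b + 1`. With `S = √((e - 1) T K ln K)` and
the tuned `γ`, the total is `(3b + 2) S + b + 3/2`. The saving of `b S` is what removes the term `2
S` once `b ≥ 2`. In the remaining cases the trivial bound `T` on the regret suffices, or there is
one arm and no regret. -/

/-! ### Truncated Laplace noise and its bias -/

theorem laplace_isProbabilityMeasure {s : ℝ} (hs : 0 < s) : IsProbabilityMeasure (laplace s) := by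
  have hint : ∫ x : ℝ, 1 / (2 * s) * Real.exp (-|x| / s) = 1 := by
    rw [integral_comp_abs (f := fun x => 1 / (2 * s) * Real.exp (-x / s)), integral_const_mul]
    have h : ∀ x : ℝ, -x / s = -s⁻¹ * x := fun x => by ring
    simp only [h]
    rw [integral_exp_mul_Ioi (neg_lt_zero.2 (inv_pos.2 hs)) 0]
    rw [mul_zero, Real.exp_zero]
    field_simp
  constructor
  rw [laplace, withDensity_apply _ MeasurableSet.univ, Measure.restrict_univ,
    ← ofReal_integral_eq_lintegral_ofReal (integrable_of_integral_eq_one hint)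
      (Filter.Eventually.of_forall fun x => by positivity), hint, ENNReal.ofReal_one]

open Classical in
/-- The gain that the base algorithm sees when the noisy gain is `x`, a rejected round counting as
gain `0`. -/
noncomputable def truncatedGain (b x : ℝ) : ℝ :=
  if x ∈ Set.Icc (-b) (b + 1) then (x + b) / (2 * b + 1) else 0

theorem measurable_truncatedGain (b : ℝ) : Measurable (truncatedGain b) := by
  unfold truncatedGain
  exact Measurable.ite measurableSet_Icc (by fun_prop) measurable_const

theorem truncatedGain_mem_Icc {b : ℝ} (hb : 0 ≤ b) (x : ℝ) :
    truncatedGain b x ∈ Set.Icc (0 : ℝ) 1 := by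
  unfold truncatedGain
  split_ifs with h
  · have h1 := h.1
    have h2 := h.2
    exact ⟨div_nonneg (by linarith) (by linarith), (div_le_one (by linarith)).2 (by linarith)⟩
  · simp

/-- The mean of the truncated gain `truncatedGain b (g + n)` under Laplace noise `n` of scale
`1 / ε`, see `integral_truncatedGain`. -/
noncomputable def meanGain (ε b g : ℝ) : ℝ :=
  (b + g + Real.exp (-(ε * (b + g))) / (2 * ε)
    - Real.exp (-(ε * (b + 1 - g))) / 2 * (2 * b + 1 + 1 / ε)) / (2 * b + 1)

theorem integral_laplace (s : ℝ) (f : ℝ → ℝ) :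
    ∫ x, f x ∂laplace s = ∫ x, max (1 / (2 * s) * Real.exp (-|x| / s)) 0 * f x := by
  rw [laplace, integral_withDensity_eq_integral_toReal_smul (by fun_prop)
    (Filter.Eventually.of_forall fun x => ENNReal.ofReal_lt_top)]
  simp only [ENNReal.toReal_ofReal', smul_eq_mul]

theorem integral_truncatedGain {ε b g : ℝ} (hε : 0 < ε) (hb : 0 ≤ b)
    (hg : g ∈ Set.Icc (0 : ℝ) 1) :
    ∫ n, truncatedGain b (g + n) ∂laplace (1 / ε) = meanGain ε b g := by
  obtain ⟨hg0, hg1⟩ := hg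
  have hind : ∀ x : ℝ, max (1 / (2 * (1 / ε)) * Real.exp (-|x| / (1 / ε))) 0 *
      truncatedGain b (g + x) = (Set.Icc (-(b + g)) (b + 1 - g)).indicator
        (fun x => ε / 2 * Real.exp (-ε * |x|) * ((x + (b + g)) / (2 * b + 1))) x := by
    intro x
    rw [max_eq_left (by positivity)]
    have h1 : (1 : ℝ) / (2 * (1 / ε)) = ε / 2 := by field_simp
    have h2 : -|x| / (1 / ε) = -ε * |x| := by field_simp
    rw [h1, h2]
    unfold truncatedGain
    by_cases h : x ∈ Set.Icc (-(b + g)) (b + 1 - g)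
    · rw [Set.indicator_of_mem h, if_pos ⟨by linarith [h.1], by linarith [h.2]⟩]
      ring
    · rw [Set.indicator_of_notMem h, if_neg (fun h' => h ⟨by linarith [h'.1], by linarith [h'.2]⟩),
        mul_zero]
  rw [integral_laplace]
  simp only [hind]
  rw [integral_indicator measurableSet_Icc, integral_Icc_eq_integral_Ioc,
    ← intervalIntegral.integral_of_le (by linarith)]
  have hcont : Continuous fun x : ℝ =>
      ε / 2 * Real.exp (-ε * |x|) * ((x + (b + g)) / (2 * b + 1)) := by fun_prop
  -- Split at the kink of `|x|`; each half has an elementary antiderivative.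
  rw [← intervalIntegral.integral_add_adjacent_intervals (b := 0)
    (hcont.intervalIntegrable _ _) (hcont.intervalIntegrable _ _)]
  have hneg : ∫ x in (-(b + g))..0, ε / 2 * Real.exp (-ε * |x|) * ((x + (b + g)) / (2 * b + 1))
      = ((b + g - 1 / ε) / 2 + Real.exp (-(ε * (b + g))) / (2 * ε)) / (2 * b + 1) := by
    have hcongr : ∫ x in (-(b + g))..0, ε / 2 * Real.exp (-ε * |x|) *
        ((x + (b + g)) / (2 * b + 1)) = ∫ x in (-(b + g))..0,
          ε / 2 * Real.exp (ε * x) * ((x + (b + g)) / (2 * b + 1)) := by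
      refine intervalIntegral.integral_congr fun x hx => ?_
      rw [Set.uIcc_of_le (by linarith)] at hx
      simp only [abs_of_nonpos hx.2, neg_mul_neg]
    rw [hcongr, intervalIntegral.integral_eq_sub_of_hasDerivAt
      (f := fun x => Real.exp (ε * x) * (x + (b + g) - 1 / ε) / 2 / (2 * b + 1))]
    · simp only [mul_zero, Real.exp_zero, mul_neg]
      field_simp
      ring
    · intro x _
      have h1 : HasDerivAt (fun x : ℝ => Real.exp (ε * x)) (Real.exp (ε * x) * (ε * 1)) x :=
        ((hasDerivAt_id x).const_mul ε).exp
      have h2 : HasDerivAt (fun x : ℝ => x + (b + g) - 1 / ε) 1 x :=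
        ((hasDerivAt_id x).add_const _).sub_const _
      refine (((h1.mul h2).div_const 2).div_const (2 * b + 1)).congr_deriv ?_
      field_simp
      ring
    · exact (Continuous.intervalIntegrable (by fun_prop) _ _)
  have hpos : ∫ x in (0 : ℝ)..(b + 1 - g),
      ε / 2 * Real.exp (-ε * |x|) * ((x + (b + g)) / (2 * b + 1))
      = ((b + g + 1 / ε) / 2 -
        Real.exp (-(ε * (b + 1 - g))) / 2 * (2 * b + 1 + 1 / ε)) / (2 * b + 1) := by
    have hcongr : ∫ x in (0 : ℝ)..(b + 1 - g), ε / 2 * Real.exp (-ε * |x|) *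
        ((x + (b + g)) / (2 * b + 1)) = ∫ x in (0 : ℝ)..(b + 1 - g),
          ε / 2 * Real.exp (-ε * x) * ((x + (b + g)) / (2 * b + 1)) := by
      refine intervalIntegral.integral_congr fun x hx => ?_
      rw [Set.uIcc_of_le (by linarith)] at hx
      simp only [abs_of_nonneg hx.1]
    rw [hcongr, intervalIntegral.integral_eq_sub_of_hasDerivAt
      (f := fun x => -(Real.exp (-ε * x) * (x + (b + g) + 1 / ε) / 2 / (2 * b + 1)))]
    · simp only [mul_zero, Real.exp_zero, neg_mul]
      field_simp
      ring
    · intro x _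
      have h1 : HasDerivAt (fun x : ℝ => Real.exp (-ε * x)) (Real.exp (-ε * x) * (-ε * 1)) x :=
        ((hasDerivAt_id x).const_mul (-ε)).exp
      have h2 : HasDerivAt (fun x : ℝ => x + (b + g) + 1 / ε) 1 x :=
        ((hasDerivAt_id x).add_const _).add_const _
      refine (((h1.mul h2).div_const 2).div_const (2 * b + 1)).neg.congr_deriv ?_
      field_simp
      ring
    · exact (Continuous.intervalIntegrable (by fun_prop) _ _)
  rw [hneg, hpos, meanGain, ← add_div]
  congr 1
  field_simp
  ring

/-- The bound is the untruncated value `(b + g) / (2b + 1)` at `g = 1`. Truncation can raise the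
mean, since rejected low gains count as `0`, but by no more than the room `1 - g` left. -/
theorem meanGain_le {ε b g : ℝ} (hε : 0 < ε) (hb : 0 ≤ b) (hg : g ∈ Set.Icc (0 : ℝ) 1) :
    meanGain ε b g ≤ (b + 1) / (2 * b + 1) := by
  obtain ⟨hg0, hg1⟩ := hg
  have h2 : 0 ≤ Real.exp (-(ε * (b + 1 - g))) / 2 * (2 * b + 1) := by positivity
  have key : Real.exp (-(ε * (b + g))) / (2 * ε) - Real.exp (-(ε * (b + 1 - g))) / (2 * ε)
      ≤ 1 - g := by
    rw [← sub_div, div_le_iff₀ (by positivity)]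
    -- The window `[-b, b + 1]` is centred at `1/2`. For `g ≥ 1/2` the difference of exponentials is
    -- nonpositive; below, it is at most `ε (1 - 2g)`.
    rcases le_total g (1 / 2) with h | h
    · have h3 : Real.exp (-(ε * (b + 1 - g)))
          = Real.exp (-(ε * (b + g))) * Real.exp (-(ε * (1 - 2 * g))) := by
        rw [← Real.exp_add]
        ring_nf
      have h4 : Real.exp (-(ε * (b + g))) ≤ 1 := Real.exp_le_one_iff.2 (by
        have : 0 ≤ ε * (b + g) := by positivity
        linarith)
      have h5 := Real.add_one_le_exp (-(ε * (1 - 2 * g)))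
      have h6 : 0 ≤ ε * (1 - 2 * g) := mul_nonneg hε.le (by linarith)
      have h7 := Real.exp_pos (-(ε * (b + g)))
      rw [h3]
      nlinarith [mul_le_mul_of_nonneg_left h5 h7.le, mul_le_mul_of_nonneg_right h4 h6]
    · have h3 : Real.exp (-(ε * (b + g))) ≤ Real.exp (-(ε * (b + 1 - g))) :=
        Real.exp_le_exp.2 (by nlinarith)
      nlinarith [mul_nonneg (sub_nonneg.2 hg1) hε.le]
  have h3 : Real.exp (-(ε * (b + 1 - g))) / 2 * (2 * b + 1 + 1 / ε)
      = Real.exp (-(ε * (b + 1 - g))) / 2 * (2 * b + 1)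
        + Real.exp (-(ε * (b + 1 - g))) / (2 * ε) := by
    field_simp
  unfold meanGain
  rw [h3]
  gcongr
  linarith

/-- Beyond its affine part, the scaled mean is `exp (-εb)` times combinations of `exp (-εx)` and
`exp (-ε(1 - x))`. Each of these varies by at most `1 - exp (-ε)` on `[0, 1]`, and this is at most
both `ε` and `1`, which keeps the bound free of `1 / ε`. -/
theorem sub_le_meanGain_sub {ε b g h : ℝ} (hε : 0 < ε) (hb : 0 ≤ b) (hg : g ∈ Set.Icc (0 : ℝ) 1)
    (hh : h ∈ Set.Icc (0 : ℝ) 1) :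
    g - h - Real.exp (-(ε * b)) * (b + 3 / 2) ≤
      (2 * b + 1) * (meanGain ε b g - meanGain ε b h) := by
  have hexp : ∀ x ∈ Set.Icc (0 : ℝ) 1, Real.exp (-(ε * x)) ∈ Set.Icc (Real.exp (-ε)) 1 :=
    fun x hx => ⟨Real.exp_le_exp.2 (by nlinarith [hx.2]),
      Real.exp_le_one_iff.2 (by nlinarith [hx.1])⟩
  have hsplit : ∀ x : ℝ, (2 * b + 1) * meanGain ε b x = b + x
      + Real.exp (-(ε * b)) * (Real.exp (-(ε * x)) / (2 * ε)
        - Real.exp (-(ε * (1 - x))) * (b + 1 / 2 + 1 / (2 * ε))) := by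
    intro x
    have h1 : Real.exp (-(ε * (b + x))) = Real.exp (-(ε * b)) * Real.exp (-(ε * x)) := by
      rw [← Real.exp_add]
      ring_nf
    have h2 : Real.exp (-(ε * (b + 1 - x)))
        = Real.exp (-(ε * b)) * Real.exp (-(ε * (1 - x))) := by
      rw [← Real.exp_add]
      ring_nf
    rw [meanGain, h1, h2, mul_div_cancel₀ _ (by linarith)]
    field_simp
    ring
  have hε1 : 1 - Real.exp (-ε) ≤ ε := by linarith [Real.add_one_le_exp (-ε)]
  have hε2 : 1 - Real.exp (-ε) ≤ 1 := by linarith [Real.exp_pos (-ε)]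
  have hsum : (1 - Real.exp (-ε)) * (b + 1 / 2 + 1 / (2 * ε))
      + (1 - Real.exp (-ε)) * (1 / (2 * ε)) ≤ b + 3 / 2 := by
    have h1 : (1 - Real.exp (-ε)) * (1 / ε) ≤ 1 := by
      rw [mul_one_div, div_le_one hε]
      exact hε1
    have h2 : (1 - Real.exp (-ε)) * (b + 1 / 2) ≤ b + 1 / 2 :=
      mul_le_of_le_one_left (by linarith) hε2
    have h3 : 1 / (2 * ε) = 1 / ε / 2 := by field_simp
    rw [h3]
    nlinarith
  have hd1 : Real.exp (-(ε * h)) - Real.exp (-(ε * g)) ≤ 1 - Real.exp (-ε) := by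
    linarith [(hexp h hh).2, (hexp g hg).1]
  have hd2 : Real.exp (-(ε * (1 - g))) - Real.exp (-(ε * (1 - h))) ≤ 1 - Real.exp (-ε) := by
    linarith [(hexp (1 - g) ⟨by linarith [hg.2], by linarith [hg.1]⟩).2,
      (hexp (1 - h) ⟨by linarith [hh.2], by linarith [hh.1]⟩).1]
  have hc : 0 ≤ b + 1 / 2 + 1 / (2 * ε) := by positivity
  have hc' : 0 ≤ 1 / (2 * ε) := by positivity
  have hE := (Real.exp_pos (-(ε * b))).le
  have h4 := mul_le_mul_of_nonneg_right hd1 hc'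
  have h5 := mul_le_mul_of_nonneg_right hd2 hc
  have h7 := mul_le_mul_of_nonneg_left (add_le_add h4 h5) hE
  have h8 := mul_le_mul_of_nonneg_left hsum hE
  rw [mul_sub, hsplit, hsplit, div_eq_mul_one_div (Real.exp (-(ε * g))),
    div_eq_mul_one_div (Real.exp (-(ε * h)))]
  linarith

/-! ### One round of EXP3 -/

/-- From the quadratic term on, the power series at `z` is dominated termwise by `z ^ 2` times the
series at `1`, whose tail sums to `e - 2`. -/
theorem exp_le_one_add_add_sq {z : ℝ} (h0 : 0 ≤ z) (h1 : z ≤ 1) :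
    Real.exp z ≤ 1 + z + (Real.exp 1 - 2) * z ^ 2 := by
  have hs : ∀ x : ℝ, HasSum (fun n : ℕ => x ^ (n + 2) / (n + 2).factorial)
      (Real.exp x - (1 + x)) := by
    intro x
    have h : HasSum (fun n : ℕ => x ^ n / n.factorial) (Real.exp x) := by
      rw [Real.exp_eq_exp_ℝ]
      exact NormedSpace.expSeries_div_hasSum_exp x
    simpa [Finset.sum_range_succ] using (hasSum_nat_add_iff' 2).2 h
  have hle := hasSum_le (fun n => ?_) (hs z) ((hs 1).mul_left (z ^ 2))
  · linarith
  · rw [one_pow, ← mul_div_assoc, mul_one]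
    gcongr ?_ / _
    exact pow_le_pow_of_le_one h0 h1 (by omega)

theorem div_le_exp3Prob {K : ℕ} {γ : ℝ} (h1 : γ ≤ 1) (G : Fin K → ℝ) (i : Fin K) :
    γ / K ≤ exp3Prob γ G i := by
  have h : 0 ≤ 1 - γ := by linarith
  unfold exp3Prob
  have : 0 ≤ (1 - γ) * (Real.exp (γ / K * G i) / ∑ j, Real.exp (γ / K * G j)) := by positivity
  linarith

theorem exp3Prob_pos {K : ℕ} [NeZero K] {γ : ℝ} (h0 : 0 < γ) (h1 : γ ≤ 1) (G : Fin K → ℝ)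
    (i : Fin K) : 0 < exp3Prob γ G i :=
  (div_pos h0 (Nat.cast_pos.2 (NeZero.pos K))).trans_le (div_le_exp3Prob h1 G i)

/-- The potential of EXP3: the total weight of the arms. -/
noncomputable def exp3Weight {K : ℕ} (γ : ℝ) (G : Fin K → ℝ) : ℝ :=
  ∑ j, Real.exp (γ / K * G j)

theorem exp3Weight_pos {K : ℕ} [NeZero K] (γ : ℝ) (G : Fin K → ℝ) : 0 < exp3Weight γ G :=
  Finset.sum_pos (fun _ _ => Real.exp_pos _) Finset.univ_nonempty

theorem exp3Weight_update {K : ℕ} (γ : ℝ) (G : Fin K → ℝ) (i : Fin K) (y : ℝ) :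
    exp3Weight γ (exp3Update γ G (i, y)) = exp3Weight γ G + Real.exp (γ / K * G i) *
      (Real.exp (γ / K * (y / exp3Prob γ G i)) - 1) := by
  have h : ∀ j, Real.exp (γ / K * exp3Update γ G (i, y) j) = Real.exp (γ / K * G j) +
      (if j = i then Real.exp (γ / K * G i) *
        (Real.exp (γ / K * (y / exp3Prob γ G i)) - 1) else 0) := by
    intro j
    simp only [exp3Update, Pi.add_apply]
    split_ifs with hj
    · subst hj
      rw [Pi.single_eq_same, mul_add, Real.exp_add]
      ring
    · rw [Pi.single_eq_of_ne hj, add_zero, add_zero]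
  simp only [exp3Weight, h, Finset.sum_add_distrib, Finset.sum_ite_eq', Finset.mem_univ, if_true]

/-- Apply `log x ≤ x - 1` to the ratio of weights, then the quadratic bound on `exp`. Exploration
serves to keep the exponent at most `1`, and the weight share of the arm times `1 - γ` is at most
its probability, which cancels the importance weight. -/
theorem log_exp3Weight_update_le {K : ℕ} [NeZero K] {γ : ℝ} (h0 : 0 < γ) (h1 : γ ≤ 1)
    (G : Fin K → ℝ) (i : Fin K) {y : ℝ} (hy : y ∈ Set.Icc (0 : ℝ) 1) :
    (1 - γ) * (K / γ * (Real.log (exp3Weight γ (exp3Update γ G (i, y)))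
      - Real.log (exp3Weight γ G))) ≤ y + (Real.exp 1 - 2) * (γ / K) * (y / exp3Prob γ G i) := by
  have hK : (0 : ℝ) < K := Nat.cast_pos.2 (NeZero.pos K)
  have hp := exp3Prob_pos h0 h1 G i
  have hW := exp3Weight_pos γ G
  have hW' := exp3Weight_pos γ (exp3Update γ G (i, y))
  have he : 0 ≤ Real.exp 1 - 2 := by linarith [Real.add_one_le_exp 1]
  obtain ⟨z, hz⟩ : ∃ z, z = γ / K * (y / exp3Prob γ G i) := ⟨_, rfl⟩
  have hz0 : 0 ≤ z := hz ▸ mul_nonneg (by positivity) (div_nonneg hy.1 hp.le)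
  have hz1 : z ≤ 1 := by
    rw [hz, ← mul_div_assoc, div_le_one hp]
    exact (mul_le_of_le_one_right (by positivity) hy.2).trans (div_le_exp3Prob h1 G i)
  have hlog : Real.log (exp3Weight γ (exp3Update γ G (i, y))) - Real.log (exp3Weight γ G) ≤
      Real.exp (γ / K * G i) / exp3Weight γ G * (z + (Real.exp 1 - 2) * z ^ 2) := by
    rw [← Real.log_div hW'.ne' hW.ne']
    refine (Real.log_le_sub_one_of_pos (div_pos hW' hW)).trans ?_
    rw [exp3Weight_update, ← hz, add_div, div_self hW.ne', add_sub_cancel_left, mul_div_right_comm]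
    refine mul_le_mul_of_nonneg_left ?_ (by positivity)
    linarith [exp_le_one_add_add_sq hz0 hz1]
  have hp' : (1 - γ) * (Real.exp (γ / K * G i) / exp3Weight γ G) ≤ exp3Prob γ G i := by
    unfold exp3Prob exp3Weight
    have : 0 ≤ γ / K := by positivity
    linarith
  calc (1 - γ) * (K / γ * (Real.log (exp3Weight γ (exp3Update γ G (i, y)))
        - Real.log (exp3Weight γ G)))
      ≤ (1 - γ) * (K / γ * (Real.exp (γ / K * G i) / exp3Weight γ G *
          (z + (Real.exp 1 - 2) * z ^ 2))) := by
        refine mul_le_mul_of_nonneg_left ?_ (by linarith)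
        exact mul_le_mul_of_nonneg_left hlog (by positivity)
    _ = (1 - γ) * (Real.exp (γ / K * G i) / exp3Weight γ G) *
          (K / γ * (z + (Real.exp 1 - 2) * z ^ 2)) := by ring
    _ ≤ exp3Prob γ G i * (K / γ * (z + (Real.exp 1 - 2) * z ^ 2)) :=
        mul_le_mul_of_nonneg_right hp' (by positivity)
    _ = y + (Real.exp 1 - 2) * (γ / K) * (y * y / exp3Prob γ G i) := by
        rw [hz]
        field_simp
    _ ≤ y + (Real.exp 1 - 2) * (γ / K) * (y / exp3Prob γ G i) := by
        have : y * y ≤ y := mul_le_of_le_one_left hy.1 hy.2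
        gcongr

/-- The regret potential of EXP3 against arm `j`. -/
noncomputable def exp3Potential {K : ℕ} (γ : ℝ) (j : Fin K) (G : Fin K → ℝ) : ℝ :=
  (1 - γ) * (G j - K / γ * Real.log (exp3Weight γ G))

theorem exp3Potential_nonpos {K : ℕ} [NeZero K] {γ : ℝ} (h0 : 0 < γ) (h1 : γ ≤ 1) (j : Fin K)
    (G : Fin K → ℝ) : exp3Potential γ j G ≤ 0 := by
  have hK : (0 : ℝ) < K := Nat.cast_pos.2 (NeZero.pos K)
  have h : γ / K * G j ≤ Real.log (exp3Weight γ G) := by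
    rw [Real.le_log_iff_exp_le (exp3Weight_pos γ G)]
    exact Finset.single_le_sum (f := fun j => Real.exp (γ / K * G j))
      (fun _ _ => (Real.exp_pos _).le) (Finset.mem_univ j)
  refine mul_nonpos_of_nonneg_of_nonpos (by linarith) (sub_nonpos.2 ?_)
  calc G j = K / γ * (γ / K * G j) := by field_simp
    _ ≤ _ := mul_le_mul_of_nonneg_left h (by positivity)

theorem exp3Potential_zero {K : ℕ} (γ : ℝ) (j : Fin K) :
    exp3Potential γ j 0 = -((1 - γ) * (K / γ * Real.log K)) := by
  simp [exp3Potential, exp3Weight]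

/-- Averaging over the arm drawn makes the importance-weighted estimates unbiased: the probability
cancels the division by it, both in the estimate of arm `j` and in the quadratic error. -/
theorem exp3Potential_add_le_sum {K : ℕ} [NeZero K] {γ : ℝ} (h0 : 0 < γ) (h1 : γ ≤ 1) (j : Fin K)
    (G : Fin K → ℝ) {y : Fin K → ℝ} (hy : ∀ i, y i ∈ Set.Icc (0 : ℝ) 1) :
    exp3Potential γ j G + (1 - γ) * y j - ∑ i, exp3Prob γ G i * y i
      - (Real.exp 1 - 2) * (γ / K) * ∑ i, y i ≤
      ∑ i, exp3Prob γ G i * exp3Potential γ j (exp3Update γ G (i, y i)) := by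
  have hterm : ∀ i, exp3Prob γ G i * exp3Potential γ j G
      + (1 - γ) * (if j = i then y i else 0) - exp3Prob γ G i * y i
      - (Real.exp 1 - 2) * (γ / K) * y i
      ≤ exp3Prob γ G i * exp3Potential γ j (exp3Update γ G (i, y i)) := by
    intro i
    have hp := exp3Prob_pos h0 h1 G i
    have hlog := mul_le_mul_of_nonneg_left (log_exp3Weight_update_le h0 h1 G i (hy i)) hp.le
    have hupd : exp3Prob γ G i * exp3Update γ G (i, y i) j
        = exp3Prob γ G i * G j + if j = i then y i else 0 := by
      simp only [exp3Update, Pi.add_apply, mul_add]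
      split_ifs with hj
      · subst hj
        rw [Pi.single_eq_same, mul_div_cancel₀ _ hp.ne']
      · rw [Pi.single_eq_of_ne hj, mul_zero]
    have hcancel : exp3Prob γ G i * (y i / exp3Prob γ G i) = y i := mul_div_cancel₀ _ hp.ne'
    have hexpand : exp3Prob γ G i * exp3Potential γ j (exp3Update γ G (i, y i))
        = (1 - γ) * (exp3Prob γ G i * exp3Update γ G (i, y i) j) - exp3Prob γ G i *
          ((1 - γ) * (K / γ * Real.log (exp3Weight γ (exp3Update γ G (i, y i))))) := by
      unfold exp3Potential
      ring
    rw [hexpand, hupd]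
    unfold exp3Potential
    linear_combination hlog + (Real.exp 1 - 2) * (γ / K) * hcancel
  have hsum := Finset.sum_le_sum fun i (_ : i ∈ Finset.univ) => hterm i
  refine le_of_eq_of_le ?_ hsum
  simp only [Finset.sum_sub_distrib, Finset.sum_add_distrib, ← Finset.mul_sum, ← Finset.sum_mul,
    exp3Prob_sum, Finset.sum_ite_eq, Finset.mem_univ, if_true, one_mul]

/-! ### The law of the arms, unrolled from the first round -/

/-- The conditional probability of the arms `a` given the gains `g` and the noise `n`, when EXP3
sees the truncated noisy gains and starts from the estimates `G`. -/
noncomputable def armsDensity {K : ℕ} (γ b : ℝ) : {T : ℕ} → (Fin K → ℝ) → (Fin T → Fin K → ℝ) →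
    (Fin T → ℝ) → (Fin T → Fin K) → ℝ
  | 0, _, _, _, _ => 1
  | _ + 1, G, g, n, a => exp3Prob γ G (a 0) *
      armsDensity γ b (exp3Update γ G (a 0, truncatedGain b (g 0 (a 0) + n 0)))
        (Fin.tail g) (Fin.tail n) (Fin.tail a)

/-- Dropping a round and feeding gain `0` agree because the update is then by `0 / p = 0`. -/
theorem exp3Estimate_filterMap_append {K : ℕ} (γ b : ℝ) (h : List (Fin K × ℝ)) (i : Fin K)
    (x : ℝ) : exp3Estimate γ ((h ++ [(i, x)]).filterMap (rescale b)) =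
      exp3Update γ (exp3Estimate γ (h.filterMap (rescale b))) (i, truncatedGain b x) := by
  by_cases hx : x ∈ Set.Icc (-b) (b + 1)
  · have h1 : rescale b (i, x) = some (i, (x + b) / (2 * b + 1)) := if_pos hx
    have h2 : truncatedGain b x = (x + b) / (2 * b + 1) := if_pos hx
    simp [h1, h2, exp3Estimate]
  · have h1 : rescale b (i, x) = none := if_neg hx
    have h2 : truncatedGain b x = 0 := if_neg hx
    simp [h1, h2, exp3Estimate, exp3Update]

/-- The prefix `h` makes the induction on `T` possible: after the first round the game restarts from
a longer history, which enters only through the estimates. -/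
theorem prod_dpLap_eq_armsDensity {K : ℕ} [NeZero K] (γ : I) (b : ℝ) {T : ℕ}
    (g : Fin T → Fin K → ℝ) (n : Fin T → ℝ) (a : Fin T → Fin K) (h : List (Fin K × ℝ)) :
    ∏ t, dpLap (exp3 γ) b (h ++ noisyHistory (g, n, a) t) (a t) = ENNReal.ofReal
      (armsDensity (γ : ℝ) b (exp3Estimate (γ : ℝ) (h.filterMap (rescale b))) g n a) := by
  induction T generalizing h with
  | zero => simp [armsDensity]
  | succ T ih =>
    have hstep : ∀ t : Fin T, h ++ noisyHistory (g, n, a) t.succ =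
        (h ++ [(a 0, g 0 (a 0) + n 0)]) ++
          noisyHistory (Fin.tail g, Fin.tail n, Fin.tail a) t := by
      intro t
      simp [noisyHistory, List.ofFn_succ, Fin.tail]
    rw [Fin.prod_univ_succ, armsDensity, ENNReal.ofReal_mul (exp3Prob_nonneg γ _ _)]
    congr 1
    · simp [noisyHistory, dpLap, exp3]
    · simp only [hstep]
      rw [← exp3Estimate_filterMap_append]
      exact ih _ _ (Fin.tail a) _

theorem armsDensity_nonneg {K : ℕ} (γ : I) (b : ℝ) {T : ℕ} (G : Fin K → ℝ)
    (g : Fin T → Fin K → ℝ) (n : Fin T → ℝ) (a : Fin T → Fin K) :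
    0 ≤ armsDensity (γ : ℝ) b G g n a := by
  induction T generalizing G with
  | zero => exact zero_le_one
  | succ T ih => exact mul_nonneg (exp3Prob_nonneg γ _ _) (ih _ _ _ _)

theorem sum_pi_fin_succ {α M : Type*} [Fintype α] [AddCommMonoid M] {T : ℕ}
    (f : (Fin (T + 1) → α) → M) :
    ∑ a, f a = ∑ i, ∑ a : Fin T → α, f (Fin.cons i a : Fin (T + 1) → α) := by
  rw [← Fintype.sum_prod_type' fun (i : α) (a : Fin T → α) =>
    f (Fin.cons i a : Fin (T + 1) → α)]
  exact (Fintype.sum_equiv (Fin.consEquiv fun _ => α) _ _ fun _ => rfl).symm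

theorem sum_armsDensity {K : ℕ} [NeZero K] (γ b : ℝ) {T : ℕ} (G : Fin K → ℝ)
    (g : Fin T → Fin K → ℝ) (n : Fin T → ℝ) : ∑ a, armsDensity γ b G g n a = 1 := by
  induction T generalizing G with
  | zero => simp [armsDensity]
  | succ T ih =>
    rw [sum_pi_fin_succ]
    simp only [armsDensity, Fin.cons_zero, Fin.tail_cons, ← Finset.mul_sum, ih, mul_one,
      exp3Prob_sum]

theorem measurable_exp3Prob {K : ℕ} (γ : ℝ) (i : Fin K) :
    Measurable fun G : Fin K → ℝ => exp3Prob γ G i := by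
  unfold exp3Prob
  fun_prop

theorem measurable_exp3Update {K : ℕ} (γ : ℝ) (i : Fin K) :
    Measurable fun p : (Fin K → ℝ) × ℝ => exp3Update γ p.1 (i, p.2) := by
  have h := measurable_exp3Prob γ i
  refine measurable_pi_lambda _ fun j => ?_
  simp only [exp3Update, Pi.add_apply]
  by_cases hj : j = i
  · subst hj
    simp only [Pi.single_eq_same]
    fun_prop
  · simp only [Pi.single_eq_of_ne hj]
    fun_prop

theorem measurable_armsDensity {K T : ℕ} (γ b : ℝ) (a : Fin T → Fin K) :
    Measurable fun q : (Fin K → ℝ) × (Fin T → Fin K → ℝ) × (Fin T → ℝ) =>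
      armsDensity γ b q.1 q.2.1 q.2.2 a := by
  induction T with
  | zero => exact measurable_const
  | succ T ih =>
    have h1 := measurable_exp3Prob γ (a 0)
    have h2 := measurable_exp3Update γ (a 0)
    have h3 := measurable_truncatedGain b
    have h4 : Measurable fun q : (Fin K → ℝ) × (Fin (T + 1) → Fin K → ℝ) × (Fin (T + 1) → ℝ) =>
        exp3Update γ q.1 (a 0, truncatedGain b (q.2.1 0 (a 0) + q.2.2 0)) :=
      h2.comp (f := fun q : (Fin K → ℝ) × (Fin (T + 1) → Fin K → ℝ) × (Fin (T + 1) → ℝ) =>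
        (q.1, truncatedGain b (q.2.1 0 (a 0) + q.2.2 0))) (by fun_prop)
    have h5 : Measurable fun q : (Fin K → ℝ) × (Fin (T + 1) → Fin K → ℝ) × (Fin (T + 1) → ℝ) =>
        (Fin.tail q.2.1 : Fin T → Fin K → ℝ) := by
      unfold Fin.tail
      fun_prop
    have h6 : Measurable fun q : (Fin K → ℝ) × (Fin (T + 1) → Fin K → ℝ) × (Fin (T + 1) → ℝ) =>
        (Fin.tail q.2.2 : Fin T → ℝ) := by
      unfold Fin.tail
      fun_prop
    exact (h1.comp measurable_fst).mul ((ih (Fin.tail a)).comp (h4.prodMk (h5.prodMk h6)))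

/-- The conditional mean, given gains and noise, of a reward `c t (a t)` collected in each
round. -/
noncomputable def armsMean {K T : ℕ} (γ b : ℝ) (c : Fin T → Fin K → ℝ) (G : Fin K → ℝ)
    (g : Fin T → Fin K → ℝ) (n : Fin T → ℝ) : ℝ :=
  ∑ a, armsDensity γ b G g n a * ∑ t, c t (a t)

theorem armsMean_cons {K : ℕ} [NeZero K] (γ b : ℝ) {T : ℕ} (c : Fin (T + 1) → Fin K → ℝ)
    (G : Fin K → ℝ) (g : Fin (T + 1) → Fin K → ℝ) (x : ℝ) (n : Fin T → ℝ) :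
    armsMean γ b c G g (Fin.cons x n : Fin (T + 1) → ℝ) = ∑ i, exp3Prob γ G i * (c 0 i +
      armsMean γ b (Fin.tail c) (exp3Update γ G (i, truncatedGain b (g 0 i + x)))
        (Fin.tail g) n) := by
  rw [armsMean, sum_pi_fin_succ]
  refine Finset.sum_congr rfl fun i _ => ?_
  simp only [armsDensity, Fin.cons_zero, Fin.tail_cons, Fin.sum_univ_succ, Fin.cons_succ,
    mul_assoc, ← Finset.mul_sum, mul_add, Finset.sum_add_distrib, ← Finset.sum_mul,
    sum_armsDensity, one_mul, armsMean]
  rfl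

theorem measurable_armsMean {K T : ℕ} (γ b : ℝ) (c : Fin T → Fin K → ℝ)
    (g : Fin T → Fin K → ℝ) (G : Fin K → ℝ) : Measurable (armsMean γ b c G g) := by
  unfold armsMean
  refine Finset.measurable_sum _ fun a _ => Measurable.mul_const ?_ _
  exact (measurable_armsDensity γ b a).comp
    (measurable_const.prodMk (measurable_const.prodMk measurable_id))

theorem abs_sum_armsDensity_mul_le {K : ℕ} [NeZero K] (γ : I) (b : ℝ) {T : ℕ} (G : Fin K → ℝ)
    (g : Fin T → Fin K → ℝ) (n : Fin T → ℝ) {f : (Fin T → Fin K) → ℝ} {C : ℝ}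
    (hf : ∀ a, |f a| ≤ C) : |∑ a, armsDensity (γ : ℝ) b G g n a * f a| ≤ C := by
  refine (Finset.abs_sum_le_sum_abs _ _).trans ?_
  have h : ∀ a ∈ Finset.univ, |armsDensity (γ : ℝ) b G g n a * f a|
      ≤ armsDensity (γ : ℝ) b G g n a * C := fun a _ => by
    rw [abs_mul, abs_of_nonneg (armsDensity_nonneg γ b G g n a)]
    exact mul_le_mul_of_nonneg_left (hf a) (armsDensity_nonneg γ b G g n a)
  refine (Finset.sum_le_sum h).trans_eq ?_
  rw [← Finset.sum_mul, sum_armsDensity, one_mul]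

theorem integrable_armsMean {K : ℕ} [NeZero K] (γ : I) (b : ℝ) {T : ℕ} (c : Fin T → Fin K → ℝ)
    (G : Fin K → ℝ) (g : Fin T → Fin K → ℝ) (ν : Measure (Fin T → ℝ)) [IsFiniteMeasure ν] :
    Integrable (armsMean (γ : ℝ) b c G g) ν := by
  refine Integrable.of_bound (measurable_armsMean _ _ _ _ _).aestronglyMeasurable
    (∑ t, ∑ i, |c t i|) (Filter.Eventually.of_forall fun n => ?_)
  refine abs_sum_armsDensity_mul_le γ b G g n fun a => ?_
  refine (Finset.abs_sum_le_sum_abs _ _).trans (Finset.sum_le_sum fun t _ => ?_)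
  exact Finset.single_le_sum (f := fun i => |c t i|) (fun _ _ => abs_nonneg _)
    (Finset.mem_univ (a t))

theorem integrable_truncatedGain {b : ℝ} (hb : 0 ≤ b) (g : ℝ) (ν : Measure ℝ)
    [IsFiniteMeasure ν] : Integrable (fun x => truncatedGain b (g + x)) ν := by
  refine Integrable.of_bound ((measurable_truncatedGain b).comp
    (measurable_const_add g)).aestronglyMeasurable 1 (Filter.Eventually.of_forall fun x => ?_)
  have h := truncatedGain_mem_Icc hb (g + x)
  exact abs_le.2 ⟨by linarith [h.1], h.2⟩

theorem integral_pi_fin_succ (ν : Measure ℝ) [IsProbabilityMeasure ν] {T : ℕ}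
    (f : (Fin (T + 1) → ℝ) → ℝ) (hf : Integrable f (Measure.pi fun _ => ν)) :
    Integrable (fun x => ∫ n, f (Fin.cons x n : Fin (T + 1) → ℝ) ∂Measure.pi fun _ => ν) ν ∧
    ∫ n, f n ∂(Measure.pi fun _ => ν) =
      ∫ x, ∫ n, f (Fin.cons x n : Fin (T + 1) → ℝ) ∂(Measure.pi fun _ => ν) ∂ν := by
  have hmp := (measurePreserving_piFinSuccAbove (fun _ : Fin (T + 1) => ν) 0).symm
  have hcons : ∀ z : ℝ × (Fin T → ℝ), (MeasurableEquiv.piFinSuccAbove (fun _ => ℝ) 0).symm z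
      = (Fin.cons z.1 z.2 : Fin (T + 1) → ℝ) := by
    intro z
    simp [MeasurableEquiv.piFinSuccAbove_symm_apply, Fin.insertNthEquiv]
  have hint : Integrable (fun z : ℝ × (Fin T → ℝ) => f (Fin.cons z.1 z.2 : Fin (T + 1) → ℝ))
      (ν.prod (Measure.pi fun _ => ν)) := by
    have h := (hmp.integrable_comp_emb (MeasurableEquiv.measurableEmbedding _)).2 hf
    refine h.congr (Filter.Eventually.of_forall fun z => ?_)
    exact congrArg f (hcons z)
  refine ⟨hint.integral_prod_left, ?_⟩
  rw [← integral_prod _ hint, ← hmp.integral_comp']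
  refine integral_congr_ae (Filter.Eventually.of_forall fun z => ?_)
  exact congrArg f (hcons z)

/-- The regret bound of EXP3, from arbitrary initial estimates: the mean rewards collected on
truncated noisy gains compare with those of any fixed arm `j`. -/
theorem exp3Potential_add_le_integral_armsMean {K : ℕ} [NeZero K] {γ : I} (h0 : (0 : ℝ) < γ)
    {b : ℝ} (hb : 0 ≤ b) (ν : Measure ℝ) [IsProbabilityMeasure ν] (j : Fin K) {T : ℕ}
    (G : Fin K → ℝ) (g c : Fin T → Fin K → ℝ)
    (hc : ∀ t i, ∫ x, truncatedGain b (g t i + x) ∂ν = c t i) :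
    exp3Potential γ j G + (1 - γ) * ∑ t, c t j
      - (Real.exp 1 - 2) * (γ / K) * ∑ t, ∑ i, c t i ≤
      ∫ n, armsMean (γ : ℝ) b c G g n ∂(Measure.pi fun _ => ν) := by
  have h1 : (γ : ℝ) ≤ 1 := γ.2.2
  induction T generalizing G with
  | zero =>
    simpa [armsMean] using exp3Potential_nonpos h0 h1 j G
  | succ T ih =>
    obtain ⟨hint, heq⟩ := integral_pi_fin_succ ν _
      (integrable_armsMean γ b c G g (Measure.pi fun _ => ν))
    rw [heq]
    have hinner : ∀ x : ℝ, ∫ n, armsMean (γ : ℝ) b c G g (Fin.cons x n : Fin (T + 1) → ℝ)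
        ∂(Measure.pi fun _ : Fin T => ν) = ∑ i, exp3Prob γ G i * (c 0 i +
          ∫ n, armsMean (γ : ℝ) b (Fin.tail c)
            (exp3Update γ G (i, truncatedGain b (g 0 i + x))) (Fin.tail g) n
            ∂(Measure.pi fun _ : Fin T => ν)) := by
      intro x
      have hi : ∀ i, Integrable (fun n => c 0 i + armsMean (γ : ℝ) b (Fin.tail c)
          (exp3Update γ G (i, truncatedGain b (g 0 i + x))) (Fin.tail g) n)
          (Measure.pi fun _ : Fin T => ν) := fun i =>
        (integrable_const _).add (integrable_armsMean γ b _ _ _ _)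
      simp only [armsMean_cons]
      rw [integral_finsetSum _ fun i _ => (hi i).const_mul _]
      refine Finset.sum_congr rfl fun i _ => ?_
      rw [integral_const_mul, integral_add (integrable_const _)
        (integrable_armsMean γ b _ _ _ _), integral_const, probReal_univ, one_smul]
    simp only [hinner] at hint ⊢
    -- `A` gathers what does not depend on the first noise `x`. Its sum of `exp3Prob γ G i * c 0 i`
    -- cancels the matching sum of truncated gains after integration over `x`.
    obtain ⟨A, hA⟩ : ∃ A : ℝ, A = exp3Potential γ j G + ∑ i, exp3Prob γ G i * c 0 i
      + (1 - γ) * ∑ t, Fin.tail c t j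
      - (Real.exp 1 - 2) * (γ / K) * ∑ t, ∑ i, Fin.tail c t i := ⟨_, rfl⟩
    have hlow : ∀ x : ℝ, A + ((1 - γ) * truncatedGain b (g 0 j + x)
        - ∑ i, exp3Prob γ G i * truncatedGain b (g 0 i + x)
        - (Real.exp 1 - 2) * (γ / K) * ∑ i, truncatedGain b (g 0 i + x)) ≤
        ∑ i, exp3Prob γ G i * (c 0 i +
          ∫ n, armsMean (γ : ℝ) b (Fin.tail c)
            (exp3Update γ G (i, truncatedGain b (g 0 i + x))) (Fin.tail g) n
            ∂(Measure.pi fun _ : Fin T => ν)) := by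
      intro x
      -- The induction hypothesis is used at each updated estimate; this inequality then compares
      -- the average updated potential with the one at `G`.
      have hstep := exp3Potential_add_le_sum h0 h1 j G
        (fun i => truncatedGain_mem_Icc hb (g 0 i + x))
      have hih := Finset.sum_le_sum fun i (_ : i ∈ Finset.univ) =>
        mul_le_mul_of_nonneg_left (add_le_add_right (ih
          (exp3Update γ G (i, truncatedGain b (g 0 i + x))) (Fin.tail g) (Fin.tail c)
          fun t i => hc t.succ i) (c 0 i)) (exp3Prob_nonneg γ G i)
      refine le_trans ?_ hih
      simp only [mul_add, mul_sub, Finset.sum_add_distrib, Finset.sum_sub_distrib,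
        ← Finset.sum_mul, exp3Prob_sum, one_mul]
      rw [hA]
      simp only [sub_mul, one_mul] at hstep ⊢
      linarith
    have hi1 : Integrable (fun x => (1 - (γ : ℝ)) * truncatedGain b (g 0 j + x)) ν :=
      (integrable_truncatedGain hb _ ν).const_mul _
    have hi2 : Integrable (fun x => ∑ i, exp3Prob γ G i * truncatedGain b (g 0 i + x)) ν :=
      integrable_finsetSum _ fun i _ => (integrable_truncatedGain hb _ ν).const_mul _
    have hi3 : Integrable (fun x => (Real.exp 1 - 2) * (γ / K) *
        ∑ i, truncatedGain b (g 0 i + x)) ν :=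
      (integrable_finsetSum _ fun i _ => integrable_truncatedGain hb _ ν).const_mul _
    have hi12 : Integrable (fun x => (1 - (γ : ℝ)) * truncatedGain b (g 0 j + x)
        - ∑ i, exp3Prob γ G i * truncatedGain b (g 0 i + x)) ν := hi1.sub hi2
    have hi123 : Integrable (fun x => (1 - (γ : ℝ)) * truncatedGain b (g 0 j + x)
        - ∑ i, exp3Prob γ G i * truncatedGain b (g 0 i + x)
        - (Real.exp 1 - 2) * (γ / K) * ∑ i, truncatedGain b (g 0 i + x)) ν := hi12.sub hi3
    refine le_trans (le_of_eq ?_) (integral_mono ((integrable_const A).add hi123) hint hlow)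
    rw [integral_add' (integrable_const A) hi123, integral_sub hi12 hi3,
      integral_sub hi1 hi2, integral_const_mul, integral_const_mul, integral_finsetSum _ fun i _ =>
      (integrable_truncatedGain hb _ ν).const_mul _, integral_finsetSum _ fun i _ =>
      integrable_truncatedGain hb _ ν, integral_const, probReal_univ, one_smul]
    simp only [integral_const_mul, hc, hA, Fin.sum_univ_succ, Fin.tail]
    ring

/-! ### From the game to a fixed table of gains -/

theorem exists_regret_eq {K T : ℕ} [NeZero K] (ω : Game K T) :
    ∃ j, regret ω = ∑ t, ω.1 t j - ∑ t, ω.1 t (ω.2.2 t) := by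
  obtain ⟨j, hj⟩ := exists_eq_ciSup_of_finite (f := fun i => ∑ t, ω.1 t i)
  exact ⟨j, by rw [regret, ← hj]⟩

theorem abs_regret_le {K T : ℕ} [NeZero K] {ω : Game K T}
    (hω : ∀ t i, ω.1 t i ∈ Set.Icc (0 : ℝ) 1) : |regret ω| ≤ T := by
  obtain ⟨j, hj⟩ := exists_regret_eq ω
  rw [hj, ← Finset.sum_sub_distrib]
  refine (Finset.abs_sum_le_sum_abs _ _).trans ?_
  refine (Finset.sum_le_sum fun t _ => ?_).trans_eq (by simp : ∑ _ : Fin T, (1 : ℝ) = T)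
  have h1 := hω t j
  have h2 := hω t (ω.2.2 t)
  exact abs_le.2 ⟨by linarith [h1.1, h2.2], by linarith [h1.2, h2.1]⟩

theorem measurable_game {K T : ℕ} {f : Game K T → ℝ}
    (hf : ∀ a, Measurable fun p : (Fin T → Fin K → ℝ) × (Fin T → ℝ) => f (p.1, p.2, a)) :
    Measurable f := by
  have h : Measurable fun q : ((Fin T → Fin K → ℝ) × (Fin T → ℝ)) × (Fin T → Fin K) =>
      f (q.1.1, q.1.2, q.2) := measurable_from_prod_countable_left hf
  exact h.comp MeasurableEquiv.prodAssoc.symm.measurable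

theorem measurable_regret {K T : ℕ} : Measurable (regret : Game K T → ℝ) := by
  refine measurable_game fun a => ?_
  change Measurable fun p : (Fin T → Fin K → ℝ) × (Fin T → ℝ) =>
    (⨆ i, ∑ t, p.1 t i) - ∑ t, p.1 t (a t)
  refine Measurable.sub (Measurable.iSup fun i => ?_) ?_ <;> fun_prop

theorem measurable_armsDensity_game {K T : ℕ} (γ b : ℝ) :
    Measurable fun ω : Game K T => armsDensity γ b 0 ω.1 ω.2.1 ω.2.2 :=
  measurable_game fun a => (measurable_armsDensity γ b a).comp (measurable_const.prodMk
    measurable_id)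

theorem gameLaw_dpLap_exp3 {K T : ℕ} [NeZero K] (γ : I) (b : ℝ) (ν : Measure ℝ)
    (μ : Measure (Fin T → Fin K → ℝ)) : gameLaw (dpLap (exp3 γ) b) ν μ =
      (μ.prod ((Measure.pi fun _ : Fin T => ν).prod Measure.count)).withDensity
        fun ω => ENNReal.ofReal (armsDensity (γ : ℝ) b 0 ω.1 ω.2.1 ω.2.2) := by
  unfold gameLaw
  congr 1
  funext ω
  exact prod_dpLap_eq_armsDensity γ b ω.1 ω.2.1 ω.2.2 []

theorem integrable_armsDensity_mul_regret {K T : ℕ} [NeZero K] (γ : I) (b : ℝ) (ν : Measure ℝ)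
    [IsProbabilityMeasure ν] {μ : Measure (Fin T → Fin K → ℝ)} (hμ : IsAdversary μ) :
    Integrable (fun ω : Game K T => armsDensity (γ : ℝ) b 0 ω.1 ω.2.1 ω.2.2 * regret ω)
      (μ.prod ((Measure.pi fun _ : Fin T => ν).prod Measure.count)) := by
  have := hμ.prob
  refine Integrable.of_bound
    ((measurable_armsDensity_game _ b).mul measurable_regret).aestronglyMeasurable T ?_
  filter_upwards [Measure.quasiMeasurePreserving_fst.ae hμ.mem_Icc] with ω hω
  rw [Real.norm_eq_abs, abs_mul, abs_of_nonneg (armsDensity_nonneg γ b _ _ _ _)]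
  refine (mul_le_mul ?_ (abs_regret_le hω) (abs_nonneg _) zero_le_one).trans_eq (one_mul _)
  rw [← sum_armsDensity (γ : ℝ) b 0 ω.1 ω.2.1]
  exact Finset.single_le_sum (fun a _ => armsDensity_nonneg γ b 0 ω.1 ω.2.1 a)
    (Finset.mem_univ ω.2.2)

theorem integrable_regret {K T : ℕ} [NeZero K] (γ : I) (b : ℝ) (ν : Measure ℝ)
    [IsProbabilityMeasure ν] {μ : Measure (Fin T → Fin K → ℝ)} (hμ : IsAdversary μ) :
    Integrable regret (gameLaw (dpLap (exp3 γ) b) ν μ) := by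
  rw [gameLaw_dpLap_exp3, integrable_withDensity_iff_integrable_smul'
    (measurable_armsDensity_game _ b).ennreal_ofReal
    (Filter.Eventually.of_forall fun _ => ENNReal.ofReal_lt_top)]
  refine (integrable_armsDensity_mul_regret γ b ν hμ).congr
    (Filter.Eventually.of_forall fun ω => ?_)
  simp only [smul_eq_mul, ENNReal.toReal_ofReal (armsDensity_nonneg γ b _ _ _ _)]

/-- As the adversary is oblivious, Fubini lets the gains be integrated last, so a bound uniform over
fixed gains is enough. -/
theorem integral_regret_le {K T : ℕ} [NeZero K] (γ : I) (b : ℝ) (ν : Measure ℝ)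
    [IsProbabilityMeasure ν] {μ : Measure (Fin T → Fin K → ℝ)} (hμ : IsAdversary μ) {B : ℝ}
    (hB : ∀ g : Fin T → Fin K → ℝ, (∀ t i, g t i ∈ Set.Icc (0 : ℝ) 1) →
      ∫ n, ∑ a, armsDensity (γ : ℝ) b 0 g n a * regret (g, n, a)
        ∂(Measure.pi fun _ : Fin T => ν) ≤ B) :
    ∫ ω, regret ω ∂(gameLaw (dpLap (exp3 γ) b) ν μ) ≤ B := by
  have := hμ.prob
  have hint := integrable_armsDensity_mul_regret γ b ν hμ
  have heq : ∫ ω, regret ω ∂(gameLaw (dpLap (exp3 γ) b) ν μ) =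
      ∫ ω : Game K T, armsDensity (γ : ℝ) b 0 ω.1 ω.2.1 ω.2.2 * regret ω
        ∂(μ.prod ((Measure.pi fun _ : Fin T => ν).prod Measure.count)) := by
    rw [gameLaw_dpLap_exp3, integral_withDensity_eq_integral_toReal_smul
      (measurable_armsDensity_game _ b).ennreal_ofReal
      (Filter.Eventually.of_forall fun _ => ENNReal.ofReal_lt_top)]
    simp only [smul_eq_mul, ENNReal.toReal_ofReal (armsDensity_nonneg γ b _ _ _ _)]
  rw [heq, integral_prod _ hint]
  have hconst : ∫ _ : Fin T → Fin K → ℝ, B ∂μ = B := by simp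
  rw [← hconst]
  refine integral_mono_ae hint.integral_prod_left (integrable_const B) ?_
  filter_upwards [hμ.mem_Icc, hint.prod_right_ae] with g hg hgint
  rw [integral_prod _ hgint]
  simp only [integral_count]
  exact hB g hg

theorem integral_sum_armsDensity_mul_regret_le_card {K T : ℕ} [NeZero K] (γ : I) (b : ℝ)
    (ν : Measure ℝ) [IsProbabilityMeasure ν] {g : Fin T → Fin K → ℝ}
    (hg : ∀ t i, g t i ∈ Set.Icc (0 : ℝ) 1) :
    ∫ n, ∑ a, armsDensity (γ : ℝ) b 0 g n a * regret (g, n, a)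
      ∂(Measure.pi fun _ : Fin T => ν) ≤ T := by
  refine (le_abs_self _).trans ?_
  have h := norm_integral_le_of_norm_le_const (μ := Measure.pi fun _ : Fin T => ν)
    (f := fun n => ∑ a, armsDensity (γ : ℝ) b 0 g n a * regret (g, n, a)) (C := T)
    (Filter.Eventually.of_forall fun n =>
      abs_sum_armsDensity_mul_le γ b 0 g n fun a => abs_regret_le hg)
  simpa using h

theorem integral_sum_armsDensity_mul_regret_le {K T : ℕ} [NeZero K] {γ : I} (h0 : (0 : ℝ) < γ)
    {ε b : ℝ} (hε : 0 < ε) (hb : 0 ≤ b) {g : Fin T → Fin K → ℝ}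
    (hg : ∀ t i, g t i ∈ Set.Icc (0 : ℝ) 1) :
    ∫ n, ∑ a, armsDensity (γ : ℝ) b 0 g n a * regret (g, n, a)
      ∂(Measure.pi fun _ : Fin T => laplace (1 / ε)) ≤
      (Real.exp 1 - 1) * γ * T * (b + 1) + (2 * b + 1) * (K / γ * Real.log K)
        + T * (Real.exp (-(ε * b)) * (b + 3 / 2)) := by
  have := laplace_isProbabilityMeasure (one_div_pos.2 hε)
  have hK : (0 : ℝ) < K := Nat.cast_pos.2 (NeZero.pos K)
  have hlogK : 0 ≤ Real.log K := Real.log_natCast_nonneg K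
  have hb1 : 0 < 2 * b + 1 := by linarith
  have he : 0 ≤ Real.exp 1 - 2 := by linarith [Real.add_one_le_exp 1]
  obtain ⟨c, hc⟩ : ∃ c : Fin T → Fin K → ℝ, ∀ t i, c t i = meanGain ε b (g t i) :=
    ⟨_, fun _ _ => rfl⟩
  obtain ⟨j, hj⟩ := exists_eq_ciSup_of_finite (f := fun i => ∑ t, g t i)
  obtain ⟨δ, hδ⟩ : ∃ δ, δ = Real.exp (-(ε * b)) * (b + 3 / 2) := ⟨_, rfl⟩
  -- The bias estimate holds on every path, round by round, so it needs no averaging over arms.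
  have hpath : ∀ n a, regret (g, n, a) ≤
      ((2 * b + 1) * ∑ t, c t j + T * δ) - (2 * b + 1) * ∑ t, c t (a t) := by
    intro n a
    have hsum := Finset.sum_le_sum fun t (_ : t ∈ Finset.univ) =>
      sub_le_meanGain_sub hε hb (hg t j) (hg t (a t))
    simp only [← hδ, ← hc, Finset.sum_sub_distrib, ← Finset.mul_sum, Finset.sum_const,
      Finset.card_univ, Fintype.card_fin, nsmul_eq_mul] at hsum
    have hreg : regret (g, n, a) = ∑ t, g t j - ∑ t, g t (a t) := by
      simp only [regret, ← hj]
    rw [hreg]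
    linarith
  have hmean : ∀ n, ∑ a, armsDensity (γ : ℝ) b 0 g n a * regret (g, n, a) ≤
      ((2 * b + 1) * ∑ t, c t j + T * δ) - (2 * b + 1) * armsMean (γ : ℝ) b c 0 g n := by
    intro n
    refine (Finset.sum_le_sum fun a _ => mul_le_mul_of_nonneg_left (hpath n a)
      (armsDensity_nonneg γ b 0 g n a)).trans_eq ?_
    simp only [mul_sub, Finset.sum_sub_distrib, ← Finset.sum_mul, sum_armsDensity, one_mul,
      armsMean, Finset.mul_sum (s := (Finset.univ : Finset (Fin T → Fin K)))]
    congr 1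
    refine Finset.sum_congr rfl fun a _ => ?_
    ring
  have hint1 : Integrable (fun n => ∑ a, armsDensity (γ : ℝ) b 0 g n a * regret (g, n, a))
      (Measure.pi fun _ : Fin T => laplace (1 / ε)) := by
    refine Integrable.of_bound (Measurable.aestronglyMeasurable ?_) T
      (Filter.Eventually.of_forall fun n =>
        abs_sum_armsDensity_mul_le γ b 0 g n fun a => abs_regret_le hg)
    exact Finset.measurable_sum _ fun a _ => ((measurable_armsDensity (γ : ℝ) b a).comp
      (measurable_const.prodMk (measurable_const.prodMk measurable_id))).mul
      (show Measurable fun n : Fin T → ℝ => regret (g, n, a) from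
        (measurable_const : Measurable fun _ : Fin T → ℝ => regret (g, (0 : Fin T → ℝ), a)))
  have hint2 := integrable_armsMean γ b c 0 g (Measure.pi fun _ : Fin T => laplace (1 / ε))
  have hlow := exp3Potential_add_le_integral_armsMean h0 hb (laplace (1 / ε)) j 0 g c
    fun t i => (integral_truncatedGain hε hb (hg t i)).trans (hc t i).symm
  rw [exp3Potential_zero] at hlow
  have hle := integral_mono hint1 ((integrable_const _).sub (hint2.const_mul (2 * b + 1))) hmean
  simp only [Pi.sub_apply] at hle
  rw [integral_sub (integrable_const _) (hint2.const_mul _), integral_const, probReal_univ,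
    one_smul, integral_const_mul] at hle
  refine hle.trans ?_
  rw [← hδ]
  have hcle : ∀ t i, c t i ≤ (b + 1) / (2 * b + 1) := fun t i =>
    (hc t i).trans_le (meanGain_le hε hb (hg t i))
  obtain ⟨m, hm⟩ : ∃ m, m = (b + 1) / (2 * b + 1) := ⟨_, rfl⟩
  have hm' : (2 * b + 1) * m = b + 1 := by rw [hm, mul_div_cancel₀ _ hb1.ne']
  have hs1 : ∑ t, c t j ≤ T * m := by
    refine (Finset.sum_le_sum fun t _ => hcle t j).trans_eq ?_
    simp [hm]
  have hs2 : ∑ t, ∑ i, c t i ≤ T * (K * m) := by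
    refine (Finset.sum_le_sum fun t _ => Finset.sum_le_sum fun i _ => hcle t i).trans_eq ?_
    simp [hm]
  have hs2' : (Real.exp 1 - 2) * (γ / K) * ∑ t, ∑ i, c t i ≤ (Real.exp 1 - 2) * γ * (T * m) := by
    refine (mul_le_mul_of_nonneg_left hs2 (by positivity)).trans_eq ?_
    field_simp
  have hs1' := mul_le_mul_of_nonneg_left hs1 h0.le
  have hlog : (1 - (γ : ℝ)) * (K / γ * Real.log K) ≤ K / γ * Real.log K :=
    mul_le_of_le_one_left (by positivity) (by linarith)
  have hfin : ∑ t, c t j - ∫ n, armsMean (γ : ℝ) b c 0 g n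
      ∂(Measure.pi fun _ : Fin T => laplace (1 / ε)) ≤
      (Real.exp 1 - 1) * γ * T * m + K / γ * Real.log K := by
    linarith
  have := mul_le_mul_of_nonneg_left hfin hb1.le
  have h3 : (Real.exp 1 - 1) * γ * T * (b + 1) = (2 * b + 1) * ((Real.exp 1 - 1) * γ * T * m) := by
    rw [← hm']
    ring
  rw [h3]
  linarith

/-! ### Tuning the parameters and the final bounds -/

theorem integral_regret_dpExp3LapLaw_le {K T : ℕ} [NeZero K] (hT : 1 ≤ T) {ε : ℝ} (hε : 0 < ε)
    {μ : Measure (Fin T → Fin K → ℝ)} (hμ : IsAdversary μ) :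
    Integrable regret (dpExp3LapLaw ε μ) ∧ ∫ ω, regret ω ∂(dpExp3LapLaw ε μ) ≤ T ∧
    (T ≤ √((Real.exp 1 - 1) * T * K * Real.log K) ∨
      ∫ ω, regret ω ∂(dpExp3LapLaw ε μ) ≤
        (3 * (Real.log T / ε) + 2) * √((Real.exp 1 - 1) * T * K * Real.log K)
          + (Real.log T / ε + 3 / 2)) := by
  have := laplace_isProbabilityMeasure (one_div_pos.2 hε)
  have hT0 : (0 : ℝ) < T := Nat.cast_pos.2 hT
  have hK : (0 : ℝ) < K := Nat.cast_pos.2 (NeZero.pos K)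
  have hlogK : 0 ≤ Real.log K := Real.log_natCast_nonneg K
  have hb : 0 ≤ Real.log T / ε := div_nonneg (Real.log_natCast_nonneg T) hε.le
  have he : 1 ≤ Real.exp 1 - 1 := by linarith [Real.add_one_le_exp 1]
  have he0 : 0 < Real.exp 1 - 1 := by linarith
  refine ⟨integrable_regret _ _ _ hμ, integral_regret_le _ _ _ hμ fun g hg =>
    integral_sum_armsDensity_mul_regret_le_card _ _ _ hg, ?_⟩
  rcases Nat.lt_or_ge 1 K with hK1 | hK1
  · have hlogK' : 0 < Real.log K := Real.log_pos (Nat.one_lt_cast.2 hK1)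
    rcases le_total 1 √(K * Real.log K / ((Real.exp 1 - 1) * T)) with hγ | hγ
    -- Here the rate is capped at `1`, so `K ln K ≥ (e - 1) T`, and the trivial bound `T` is already
    -- below the square root.
    · left
      refine Real.le_sqrt_of_sq_le ?_
      rw [Real.one_le_sqrt, one_le_div (by positivity)] at hγ
      calc (T : ℝ) ^ 2 ≤ T * ((Real.exp 1 - 1) * (K * Real.log K)) := by
            rw [sq]
            refine mul_le_mul_of_nonneg_left ?_ hT0.le
            have h1 := le_mul_of_one_le_left hT0.le he
            have h2 := le_mul_of_one_le_left (mul_nonneg hK.le hlogK) he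
            linarith
        _ = _ := by ring
    · right
      have hrate : (exp3Rate K T : ℝ) = √(K * Real.log K / ((Real.exp 1 - 1) * T)) :=
        min_eq_right hγ
      obtain ⟨r, hr⟩ : ∃ r, r = √(K * Real.log K / ((Real.exp 1 - 1) * T)) := ⟨_, rfl⟩
      have hr0 : 0 < r := hr ▸ Real.sqrt_pos.2 (by positivity)
      have hr2 : r ^ 2 * ((Real.exp 1 - 1) * T) = K * Real.log K := by
        rw [hr, Real.sq_sqrt (by positivity), div_mul_cancel₀ _ (by positivity)]
      -- This rate balances the two EXP3 terms: both basic quantities equal the square root, with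
      -- coefficients `b + 1` and `2b + 1`.
      have hS : √((Real.exp 1 - 1) * T * K * Real.log K) = (Real.exp 1 - 1) * r * T := by
        rw [Real.sqrt_eq_iff_mul_self_eq (by positivity) (by positivity)]
        linear_combination -((Real.exp 1 - 1) * T * hr2)
      have hS' : K / r * Real.log K = (Real.exp 1 - 1) * r * T := by
        field_simp
        linear_combination -hr2
      refine integral_regret_le _ _ _ hμ fun g hg => ?_
      have h0 : (0 : ℝ) < exp3Rate K T := by rw [hrate, ← hr]; exact hr0
      refine (integral_sum_armsDensity_mul_regret_le h0 hε hb hg).trans_eq ?_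
      have hexp : Real.exp (-(ε * (Real.log T / ε))) = 1 / T := by
        rw [mul_div_cancel₀ _ hε.ne', Real.exp_neg, Real.exp_log hT0, one_div]
      rw [hrate, ← hr, hexp, hS, hS']
      field_simp
      ring
  -- With a single arm the rate is `0` and the EXP3 bound is unavailable, but the regret vanishes.
  · right
    have : Subsingleton (Fin K) := Fin.subsingleton_iff_le_one.2 hK1
    refine (integral_regret_le (B := 0) _ _ _ hμ fun g hg => ?_).trans (by positivity)
    have hreg : ∀ n a, regret (g, n, a) = 0 := by
      intro n a
      obtain ⟨j, hj⟩ := exists_regret_eq (g, n, a)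
      rw [hj, sub_eq_zero]
      exact Finset.sum_congr rfl fun t _ => congrArg (g t) (Subsingleton.elim _ _)
    simp [hreg]

/-- `log x ≤ x - 1` at `x = √T` gives `2√T`. This absorbs the bias `ln T / ε` into the last term of
the bound. -/
theorem log_le_sqrt_mul {T : ℕ} (hT : 1 ≤ T) : Real.log T ≤ √(32 * T) := by
  have hT0 : (0 : ℝ) < T := Nat.cast_pos.2 hT
  have h1 := Real.log_le_sub_one_of_pos (Real.sqrt_pos.2 hT0)
  rw [Real.log_sqrt hT0.le] at h1
  have h2 : 2 * √(T : ℝ) ≤ √(32 * T) := by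
    refine Real.le_sqrt_of_sq_le ?_
    rw [mul_pow, Real.sq_sqrt hT0.le]
    linarith
  linarith

theorem integral_regret_dpExp3LapLaw_le_of_le {K T : ℕ} [NeZero K] (hT : 1 ≤ T) {ε : ℝ}
    (hε : 0 < ε) (h : ε ≤ 1 ∨ 2 * ε ≤ Real.log T) {μ : Measure (Fin T → Fin K → ℝ)}
    (hμ : IsAdversary μ) : ∫ ω, regret ω ∂(dpExp3LapLaw ε μ) ≤
      4 * Real.log T / ε * √((Real.exp 1 - 1) * T * K * Real.log K)
        + 2 * K + √(32 * T) / ε := by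
  have hT0 : (0 : ℝ) < T := Nat.cast_pos.2 hT
  have hK : (1 : ℝ) ≤ K := Nat.one_le_cast.2 (NeZero.pos K)
  have hlogT : 0 ≤ Real.log T := Real.log_natCast_nonneg T
  obtain ⟨-, hle, hcase⟩ := integral_regret_dpExp3LapLaw_le hT hε hμ
  have hS := Real.sqrt_nonneg ((Real.exp 1 - 1) * T * K * Real.log K)
  have hb := div_le_div_of_nonneg_right (log_le_sqrt_mul hT) hε.le
  have hb0 : 0 ≤ Real.log T / ε := div_nonneg hlogT hε.le
  rw [mul_div_assoc]
  -- If `b ≥ 2` then `3b + 2 ≤ 4b`. Otherwise `ε ≤ 1` forces `T < e ^ 2 < 32`, and the trivial bound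
  -- `T ≤ √(32 T) / ε` wins.
  rcases le_or_gt (2 * ε) (Real.log T) with h2 | h2
  · have hb2 : 2 ≤ Real.log T / ε := (le_div_iff₀ hε).2 h2
    rcases hcase with hc | hc <;> nlinarith
  · have hε1 : ε ≤ 1 := h.resolve_right (not_le.2 h2)
    have hT32 : (T : ℝ) ≤ 32 := by
      have h3 : (T : ℝ) < Real.exp 2 := (Real.log_lt_iff_lt_exp hT0).1 (by linarith)
      have h4 : Real.exp 2 = Real.exp 1 * Real.exp 1 := by
        rw [← Real.exp_add]
        norm_num
      nlinarith [Real.exp_one_lt_d9, Real.exp_pos 1]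
    have h5 : (T : ℝ) ≤ √(32 * T) := Real.le_sqrt_of_sq_le (by nlinarith)
    have h6 : √(32 * T) ≤ √(32 * T) / ε := le_div_self (Real.sqrt_nonneg _) hε hε1
    have h7 := mul_nonneg (mul_nonneg zero_le_four hb0) hS
    linarith

/-- In both regimes `ln T / ε` stays above `ln 2`, so even the constant `2K` is a multiple of the
rate. -/
theorem dpExp3Lap_bound_le {K T : ℕ} [NeZero K] (hT : 2 ≤ T) {ε : ℝ} (hε : 0 < ε)
    (h : ε ≤ 1 ∨ 2 * ε ≤ Real.log T) :
    4 * Real.log T / ε * √((Real.exp 1 - 1) * T * K * Real.log K) + 2 * K + √(32 * T) / ε ≤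
      (4 * √((Real.exp 1 - 1) * (K * Real.log K)) + 2 * K / Real.log 2 + √32 / Real.log 2) *
        (√T * Real.log T / ε) := by
  have hT1 : (2 : ℝ) ≤ T := by exact_mod_cast hT
  have hl2 : 0 < Real.log 2 := Real.log_pos one_lt_two
  have hl2' : Real.log 2 ≤ 2 := by linarith [Real.log_le_sub_one_of_pos (zero_lt_two (α := ℝ))]
  have hlogT : Real.log 2 ≤ Real.log T := Real.log_le_log two_pos hT1
  have hb : Real.log 2 ≤ Real.log T / ε := by
    rw [le_div_iff₀ hε]
    rcases h with h | h
    · exact (mul_le_of_le_one_right hl2.le h).trans hlogT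
    · exact (mul_le_mul_of_nonneg_right hl2' hε.le).trans h
  have hsT : 1 ≤ √(T : ℝ) := Real.one_le_sqrt.2 (by linarith)
  have h1 : √((Real.exp 1 - 1) * T * K * Real.log K)
      = √T * √((Real.exp 1 - 1) * (K * Real.log K)) := by
    rw [← Real.sqrt_mul (Nat.cast_nonneg T)]
    congr 1
    ring
  have h2 : 2 * (K : ℝ) ≤ 2 * K / Real.log 2 * (√T * Real.log T / ε) := by
    rw [div_mul_eq_mul_div, le_div_iff₀ hl2, mul_div_assoc]
    refine mul_le_mul_of_nonneg_left ?_ (by positivity)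
    exact hb.trans (le_mul_of_one_le_left (hl2.le.trans hb) hsT)
  have h3 : √(32 * T) / ε ≤ √32 / Real.log 2 * (√T * Real.log T / ε) := by
    rw [Real.sqrt_mul (by norm_num)]
    calc √32 * √T / ε = √32 / Real.log 2 * (√T * Real.log 2 / ε) := by field_simp
      _ ≤ _ := by gcongr
  rw [h1]
  calc _ ≤ 4 * Real.log T / ε * (√T * √((Real.exp 1 - 1) * (K * Real.log K)))
        + 2 * K / Real.log 2 * (√T * Real.log T / ε)
        + √32 / Real.log 2 * (√T * Real.log T / ε) := by linarith
    _ = _ := by ring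

end DPBandit

theorem mainTheorem2 (K : ℕ) [NeZero K] :
    -- every privacy parameter: the rescaling factor `2 * b + 1` in full
    (∀ (T : ℕ) (ε : ℝ), 1 ≤ T → 0 < ε →
      ∀ μ : MeasureTheory.Measure (Fin T → Fin K → ℝ), DPBandit.IsAdversary μ →
        MeasureTheory.Integrable DPBandit.regret (DPBandit.dpExp3LapLaw ε μ) ∧
        ∫ ω, DPBandit.regret ω ∂(DPBandit.dpExp3LapLaw ε μ) ≤
          (4 * Real.log T / ε + 2) * √((Real.exp 1 - 1) * T * K * Real.log K)
            + 2 * K + √(32 * T) / ε) ∧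
    -- `ε ≤ 1`, or `T` large enough for `ε`: the lower-order term `2 * √(⋯)` is not needed
    (∀ (T : ℕ) (ε : ℝ), 1 ≤ T → 0 < ε → (ε ≤ 1 ∨ 2 * ε ≤ Real.log T) →
      ∀ μ : MeasureTheory.Measure (Fin T → Fin K → ℝ), DPBandit.IsAdversary μ →
        ∫ ω, DPBandit.regret ω ∂(DPBandit.dpExp3LapLaw ε μ) ≤
          4 * Real.log T / ε * √((Real.exp 1 - 1) * T * K * Real.log K)
            + 2 * K + √(32 * T) / ε) ∧
    -- the rate, with a constant that depends on the number of arms only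
    (∃ C : ℝ, ∀ (T : ℕ) (ε : ℝ), 2 ≤ T → 0 < ε → (ε ≤ 1 ∨ 2 * ε ≤ Real.log T) →
      ∀ μ : MeasureTheory.Measure (Fin T → Fin K → ℝ), DPBandit.IsAdversary μ →
        ∫ ω, DPBandit.regret ω ∂(DPBandit.dpExp3LapLaw ε μ) ≤
          C * (√T * Real.log T / ε)) := by
  refine ⟨fun T ε hT hε μ hμ => ?_, fun T ε hT hε h μ hμ =>
    DPBandit.integral_regret_dpExp3LapLaw_le_of_le hT hε h hμ, _, fun T ε hT hε h μ hμ =>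
    (DPBandit.integral_regret_dpExp3LapLaw_le_of_le (by omega) hε h hμ).trans
      (DPBandit.dpExp3Lap_bound_le hT hε h)⟩
  obtain ⟨hint, hle, hcase⟩ := DPBandit.integral_regret_dpExp3LapLaw_le hT hε hμ
  refine ⟨hint, ?_⟩
  have hK : (1 : ℝ) ≤ K := Nat.one_le_cast.2 (NeZero.pos K)
  have hS := Real.sqrt_nonneg ((Real.exp 1 - 1) * T * K * Real.log K)
  have hb := div_le_div_of_nonneg_right (DPBandit.log_le_sqrt_mul hT) hε.le
  have hb0 : 0 ≤ Real.log T / ε := div_nonneg (Real.log_natCast_nonneg T) hε.le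
  rw [mul_div_assoc]
  -- Uses `3b + 2 ≤ 4b + 2`, `b ≤ √(32 T) / ε` and `3/2 ≤ 2K`, or `T ≤ S ≤ (4b + 2) S` with `S` the
  -- square root.
  rcases hcase with hc | hc <;> nlinarith
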